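/- Let $y,z,k$ be positive integers with $k>16$ and $k>yz$. Suppose that (a) $\Sigma:=\dfrac{8(z^2+k)}{k-16}$ is an integer, (b) $\Sigma':=\dfrac{y^2\Sigma}{k}$ is an integer, (c) $x:=\sqrt{\dfrac{k(\Sigma+\Sigma')}{8}}$ is an integer. Then one of the following holds: (a) $(\Sigma,\Sigma')$ is one of $(9,9),(12,24),(16,16),(24,12),(10,40),(40,10),(18,32)$; (b) $(\Sigma,\Sigma')=(5m^2,5)$ for some integer $m$ for which there exist integers $n,Y,Z$ such that $m^2-10n^2=-1$ and $(5m^2-8)Y^2=5+8Z^2$; (c) $(\Sigma,\Sigma')=(m^2,1)$ for some integer $m$ for which there exist integers $n,Y,Z$ such that $m^2-2n^2=-1$ and $(m^2-8)Y^2=1+8Z^2$. -/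

import Mathlib

/-! Write S, S' for Σ, Σ'. Eliminating k gives (S - 8)Sy² = 8S'z² + 16SS', and eliminating x shows
that 2SS'(S + S') is a square. The first definition also forces S > 8.

If S' ≥ 9, then yz < k yields k(SS' - 8S - 8S') < 16SS'. For k ≥ 200 this leaves finitely many pairs
(S, S'), and for k < 200 there are finitely many triples (k, z, y); both ranges are searched by
computation (`isSporadic_of_ge`, `isSporadic_of_lt_two_hundred`).

If S' ≤ 8, the square condition is treated for each value of S'. For S' = 2, 8 it traps a square
between consecutive squares. Otherwise it splits into two coprime factors, each a square up to a
divisor of a squarefree d (`exists_sq_of_squarefree_mul_coprime`). Each splitting is impossible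
modulo a small prime, or is refuted by descent in the first equation followed by a congruence modulo
3, 7 or 8, or is a negative Pell equation; the last occurs only for S' = 1 and 5. -/

/-! ### Coprime splitting of squares, and divisibility between squares. -/

theorem exists_sq_of_squarefree_mul_coprime {d : ℕ} (hd : Squarefree d) {A B c : ℤ}
    (hA : 0 < A) (hB : 0 < B) (hAB : IsCoprime A B) (h : d * (A * B) = c ^ 2) :
    ∃ d₁ d₂ : ℕ, d₁ * d₂ = d ∧ ∃ a b : ℤ, A = d₁ * a ^ 2 ∧ B = d₂ * b ^ 2 := by
  lift A to ℕ using hA.le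
  lift B to ℕ using hB.le
  rw [← sq_abs, ← Int.natCast_natAbs] at h
  set e := c.natAbs
  have hco : Nat.Coprime A B := Nat.isCoprime_iff_coprime.1 hAB
  have h' : d * (A * B) = e ^ 2 := by exact_mod_cast h
  have hde : d ∣ e := (hd.dvd_pow_iff_dvd two_ne_zero).1 ⟨_, h'.symm⟩
  obtain ⟨f, hf⟩ := hde
  have hd0 : 0 < d := Nat.pos_of_ne_zero hd.ne_zero
  have h1 : A * B = d * f ^ 2 := by
    apply Nat.eq_of_mul_eq_mul_left hd0
    rw [h', hf]; ring
  -- As A and B are coprime and d divides AB, d factors exactly into its parts in A and in B; the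
  -- cofactors are then coprime with square product.
  have hg : d.gcd A * d.gcd B = d := by
    rw [← Nat.Coprime.gcd_mul d hco, h1]; simp
  obtain ⟨A', hA'⟩ := Nat.gcd_dvd_right d A
  obtain ⟨B', hB'⟩ := Nat.gcd_dvd_right d B
  have h2 : A' * B' = f ^ 2 := by
    apply Nat.eq_of_mul_eq_mul_left hd0
    calc d * (A' * B') = (d.gcd A * d.gcd B) * (A' * B') := by rw [hg]
      _ = (d.gcd A * A') * (d.gcd B * B') := by ring
      _ = d * f ^ 2 := by rw [← hA', ← hB', h1]
  have hco' : Nat.Coprime A' B' :=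
    Nat.Coprime.of_dvd ⟨_, hA'.trans (mul_comm _ _)⟩ ⟨_, hB'.trans (mul_comm _ _)⟩ hco
  obtain ⟨a, ha⟩ := exists_eq_pow_of_mul_eq_pow (isUnit_iff_eq_one.mpr hco') h2
  obtain ⟨b, hb⟩ := exists_eq_pow_of_mul_eq_pow (isUnit_iff_eq_one.mpr hco'.symm)
    ((mul_comm _ _).trans h2)
  refine ⟨_, _, hg, a, b, ?_, ?_⟩
  · rw [ha] at hA'; exact_mod_cast hA'
  · rw [hb] at hB'; exact_mod_cast hB'

theorem dvd_of_sq_dvd_two_mul_sq {a z : ℤ} (h : a ^ 2 ∣ 2 * z ^ 2) : a ∣ z := by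
  rcases eq_or_ne a 0 with rfl | ha
  · have : z = 0 := by simpa using h
    simp [this]
  obtain ⟨g, a', z', hg, hco, rfl, rfl⟩ : ∃ g a' z' : ℤ, g ≠ 0 ∧ IsCoprime a' z' ∧
      a = g * a' ∧ z = g * z' := by
    obtain ⟨g, a', z', h1, h2, h3, h4⟩ := Int.exists_gcd_one' (m := a) (n := z) (Int.gcd_pos_of_ne_zero_left _ ha)
    exact ⟨g, a', z', by positivity, Int.isCoprime_iff_gcd_eq_one.2 h2, by rw [h3]; ring, by rw [h4]; ring⟩
  have h1 : a' ^ 2 ∣ 2 * z' ^ 2 := by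
    have : g ^ 2 * a' ^ 2 ∣ g ^ 2 * (2 * z' ^ 2) := by
      convert h using 1 <;> ring
    exact (mul_dvd_mul_iff_left (pow_ne_zero 2 hg)).1 this
  have h2 : a' ^ 2 ∣ 2 := (hco.pow (m := 2) (n := 2)).dvd_of_dvd_mul_right h1
  have h3 : IsUnit a' := by
    have : Squarefree (2 : ℤ) := Int.prime_two.squarefree
    exact this a' (by rwa [← sq])
  exact mul_dvd_mul_left g (h3.dvd)

theorem dvd_of_sq_dvd_two_pow_mul_sq {a z : ℤ} (n : ℕ) (ha : a % 2 = 1)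
    (h : a ^ 2 ∣ 2 ^ n * z ^ 2) : a ∣ z := by
  have hco : IsCoprime a 2 := by
    refine ⟨1, -(a / 2), ?_⟩
    omega
  have : IsCoprime (a ^ 2) (2 ^ n) := hco.pow
  exact (Int.pow_dvd_pow_iff two_ne_zero).1 (this.dvd_of_dvd_mul_left h)

/-! ### Finite searches for the sporadic pairs. -/

/-- The sporadic pairs. -/
def IsSporadic (S S' : ℕ) : Prop :=
  (S, S') ∈ [(9, 9), (12, 24), (16, 16), (24, 12), (10, 40), (40, 10), (18, 32)]

instance (S S' : ℕ) : Decidable (IsSporadic S S') := by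
  unfold IsSporadic; infer_instance

-- The bound on `y` encodes yz < k. The outer function names S, S' and k(S + S')/8, and the equation
-- with `Nat.sqrt` tests that 8 divides k(S + S') with a square quotient.
set_option synthInstance.maxHeartbeats 400000 in
set_option synthInstance.maxSize 10000 in
theorem isSporadic_of_lt_two_hundred : ∀ k < 200, 16 < k → ∀ z < k, 0 < z → (k - 16) ∣ 8 * (z * z + k) →
    ∀ y < (k - 1) / z + 1, k ∣ y * y * (8 * (z * z + k) / (k - 16)) →
    (fun S S' s : ℕ => 9 ≤ S' → 8 * (s.sqrt * s.sqrt) = k * (S + S') →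
      IsSporadic S S') (8 * (z * z + k) / (k - 16))
      (y * y * (8 * (z * z + k) / (k - 16)) / k)
      (k * (8 * (z * z + k) / (k - 16) + y * y * (8 * (z * z + k) / (k - 16)) / k) / 8) := by
  decide +kernel

-- The inequality with m, n ≥ 9 forces the smaller number below 18 and then the larger below 260.
-- The pair (9, 72) passes the square test and is refuted separately modulo 8.
set_option synthInstance.maxHeartbeats 400000 in
set_option synthInstance.maxSize 10000 in
theorem isSporadic_or_of_sq : ∀ m < 18, 9 ≤ m → ∀ n < 260, 9 ≤ n →
    23 * m * n < 200 * (m + n) →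
    (2 * m * n * (m + n)).sqrt * (2 * m * n * (m + n)).sqrt = 2 * m * n * (m + n) →
    IsSporadic m n ∨ (m = 9 ∧ n = 72) := by
  decide +kernel

/-! ### Local obstructions for the splittings with S' ≤ 7. -/

theorem dvd_of_mul_sq_eq {p c y e : ℤ} (hp : Prime p) (hc : ¬ p ∣ c)
    (h : c * y ^ 2 = p * e) : p ∣ y :=
  hp.dvd_of_dvd_pow ((hp.dvd_mul.1 ⟨e, h⟩).resolve_left hc)

theorem sq_emod_eight (n : ℤ) :
    n % 2 = 1 ∧ n ^ 2 % 8 = 1 ∨ n % 2 = 0 ∧ (n ^ 2 % 8 = 0 ∨ n ^ 2 % 8 = 4) := by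
  have h : n % 8 = 0 ∨ n % 8 = 1 ∨ n % 8 = 2 ∨ n % 8 = 3 ∨ n % 8 = 4 ∨ n % 8 = 5 ∨
    n % 8 = 6 ∨ n % 8 = 7 := by omega
  rcases h with h | h | h | h | h | h | h | h <;> simp [pow_two, Int.mul_emod, h] <;> omega

theorem prime_five_int : Prime (5 : ℤ) := Nat.prime_iff_prime_int.1 Nat.prime_five

theorem prime_seven_int : Prime (7 : ℤ) := Nat.prime_iff_prime_int.1 (by norm_num : Nat.Prime 7)

/-- The model for the `no_solution` lemmas on splittings: S is a constant times a square, whose root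
divides out of z; common small primes are then stripped from the variables until a congruence fails.
-/
theorem no_solution_one {u v y z : ℤ} (hu : u ≠ 0) (huv : 2 * u ^ 2 + 1 = v ^ 2)
    (h : (2 * u ^ 2 - 8) * (2 * u ^ 2) * y ^ 2 = 8 * 1 * z ^ 2 + 16 * (2 * u ^ 2) * 1) :
    False := by
  obtain ⟨w, rfl⟩ : u ∣ z := dvd_of_sq_dvd_two_mul_sq
    ⟨(u ^ 2 - 4) * y ^ 2 - 8, by linarith⟩
  have h1 : (u ^ 2 - 4) * y ^ 2 = 2 * w ^ 2 + 8 := by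
    apply mul_left_cancel₀ (pow_ne_zero 2 hu); linarith
  obtain ⟨s, rfl⟩ : 2 ∣ u := by
    have := sq_emod_eight u; have := sq_emod_eight v; omega
  obtain ⟨t, rfl⟩ : 2 ∣ w := dvd_of_mul_sq_eq (c := 1) (e := (s ^ 2 - 1) * y ^ 2 - 2)
    Int.prime_two (by norm_num) (by linarith)
  have h2 : (s ^ 2 - 1) * y ^ 2 = 2 * (t ^ 2 + 1) := by linarith
  obtain ⟨r, rfl⟩ | hs := Int.even_or_odd s
  · obtain ⟨x, rfl⟩ : 2 ∣ y := dvd_of_mul_sq_eq Int.prime_two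
      (by have := sq_emod_eight (r + r); omega) h2
    have h3 : 2 * (4 * r ^ 2 - 1) * x ^ 2 = t ^ 2 + 1 := by linarith
    have h4 := congrArg (Int.cast : ℤ → ZMod 8) h3
    push_cast at h4
    generalize (r : ZMod 8) = r, (t : ZMod 8) = t, (x : ZMod 8) = x at h4
    revert r t x; decide
  -- For odd s the left side of `h2` is divisible by 8, whereas 2(t² + 1) is 2 or 4 modulo 8.
  · have hs1 : 8 ∣ (s ^ 2 - 1) * y ^ 2 := Dvd.dvd.mul_right
      (by have := sq_emod_eight s; have := Int.odd_iff.1 hs; omega) _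
    have := sq_emod_eight t
    omega

theorem no_solution_three_of_six_mul_sq {a y z : ℤ} (ha : a ≠ 0)
    (h : (18 * a ^ 2 - 8) * (18 * a ^ 2) * y ^ 2 = 8 * 3 * z ^ 2 + 16 * (18 * a ^ 2) * 3) :
    False := by
  obtain ⟨w, rfl⟩ : a ∣ z := dvd_of_sq_dvd_two_mul_sq
    ⟨3 * (9 * a ^ 2 - 4) * y ^ 2 - 72, by linarith⟩
  have h1 : 3 * (9 * a ^ 2 - 4) * y ^ 2 = 2 * w ^ 2 + 72 := by
    apply mul_left_cancel₀ (pow_ne_zero 2 ha); linarith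
  obtain ⟨w, rfl⟩ : 3 ∣ w := dvd_of_mul_sq_eq (c := 2) (e := (9 * a ^ 2 - 4) * y ^ 2 - 24)
    Int.prime_three (by norm_num) (by linarith)
  obtain ⟨y, rfl⟩ : 3 ∣ y := dvd_of_mul_sq_eq (c := 9 * a ^ 2 - 4) (e := 2 * w ^ 2 + 8)
    Int.prime_three (by omega) (by linarith)
  have h2 : 3 * (9 * a ^ 2 - 4) * y ^ 2 = 2 * w ^ 2 + 8 := by linarith
  have h3 := congrArg (Int.cast : ℤ → ZMod 3) h2
  push_cast at h3
  generalize (a : ZMod 3) = a, (w : ZMod 3) = w, (y : ZMod 3) = y at h3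
  revert a w y; decide

theorem no_solution_three_of_two_mul_sq {a y z : ℤ} (ha : a % 2 = 1)
    (h : (6 * a ^ 2 - 8) * (6 * a ^ 2) * y ^ 2 = 8 * 3 * z ^ 2 + 16 * (6 * a ^ 2) * 3) :
    False := by
  have ha0 : a ≠ 0 := by rintro rfl; simp at ha
  obtain ⟨w, rfl⟩ : a ∣ z := dvd_of_sq_dvd_two_mul_sq
    ⟨(3 * a ^ 2 - 4) * y ^ 2 - 24, by linarith⟩
  have h1 : (3 * a ^ 2 - 4) * y ^ 2 = 2 * w ^ 2 + 24 := by
    apply mul_left_cancel₀ (pow_ne_zero 2 ha0); linarith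
  have ha8 := sq_emod_eight a
  obtain ⟨q, hq⟩ : ∃ q, a ^ 2 = 8 * q + 1 := ⟨a ^ 2 / 8, by omega⟩
  rw [hq] at h1
  obtain ⟨y, rfl⟩ : 2 ∣ y := dvd_of_mul_sq_eq (e := w ^ 2 + 12)
    Int.prime_two (by omega) (h1.trans (by ring))
  obtain ⟨w, rfl⟩ : 2 ∣ w := dvd_of_mul_sq_eq (c := 1)
    (e := (3 * (8 * q + 1) - 4) * y ^ 2 - 6) Int.prime_two (by norm_num) (by linarith)
  obtain ⟨y, rfl⟩ : 2 ∣ y := dvd_of_mul_sq_eq (c := 3 * (8 * q + 1) - 4)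
    (e := w ^ 2 + 3) Int.prime_two (by omega) (by linarith)
  have h2 : 2 * (3 * (8 * q + 1) - 4) * y ^ 2 = w ^ 2 + 3 := by linarith
  have h3 := congrArg (Int.cast : ℤ → ZMod 8) h2
  push_cast at h3
  generalize (q : ZMod 8) = q, (w : ZMod 8) = w, (y : ZMod 8) = y at h3
  revert q w y; decide

theorem no_solution_four_of_sq {a y z : ℤ} (ha : a % 2 = 1)
    (h : (4 * a ^ 2 - 8) * (4 * a ^ 2) * y ^ 2 = 8 * 4 * z ^ 2 + 16 * (4 * a ^ 2) * 4) :
    False := by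
  have ha0 : a ≠ 0 := by rintro rfl; simp at ha
  obtain ⟨w, rfl⟩ : a ∣ z := dvd_of_sq_dvd_two_mul_sq
    ⟨(a ^ 2 - 2) * y ^ 2 - 16, by linarith⟩
  have h1 : (a ^ 2 - 2) * y ^ 2 = 2 * w ^ 2 + 16 := by
    apply mul_left_cancel₀ (pow_ne_zero 2 ha0); linarith
  have ha8 := sq_emod_eight a
  obtain ⟨q, hq⟩ : ∃ q, a ^ 2 = 8 * q + 1 := ⟨a ^ 2 / 8, by omega⟩
  rw [hq] at h1
  obtain ⟨y, rfl⟩ : 2 ∣ y := dvd_of_mul_sq_eq (e := w ^ 2 + 8)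
    Int.prime_two (by omega) (h1.trans (by ring))
  obtain ⟨w, rfl⟩ : 2 ∣ w := dvd_of_mul_sq_eq (c := 1)
    (e := (8 * q + 1 - 2) * y ^ 2 - 4) Int.prime_two (by norm_num) (by linarith)
  obtain ⟨y, rfl⟩ : 2 ∣ y := dvd_of_mul_sq_eq (c := 8 * q + 1 - 2)
    (e := w ^ 2 + 2) Int.prime_two (by omega) (by linarith)
  obtain ⟨w, rfl⟩ : 2 ∣ w := dvd_of_mul_sq_eq (c := 1)
    (e := (8 * q + 1 - 2) * y ^ 2 - 1) Int.prime_two (by norm_num) (by linarith)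
  have h2 : (8 * q + 1 - 2) * y ^ 2 = 2 * w ^ 2 + 1 := by linarith
  have h3 := congrArg (Int.cast : ℤ → ZMod 8) h2
  push_cast at h3
  generalize (q : ZMod 8) = q, (w : ZMod 8) = w, (y : ZMod 8) = y at h3
  revert q w y; decide

theorem no_solution_four_of_two_mul_sq {u v y z : ℤ} (hu : u ≠ 0) (huv : 2 * u ^ 2 + 1 = v ^ 2)
    (h : (8 * u ^ 2 - 8) * (8 * u ^ 2) * y ^ 2 = 8 * 4 * z ^ 2 + 16 * (8 * u ^ 2) * 4) :
    False := by
  obtain ⟨w, rfl⟩ : u ∣ z := dvd_of_sq_dvd_two_mul_sq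
    ⟨4 * (u ^ 2 - 1) * y ^ 2 - 32, by linarith⟩
  have h1 : 2 * (u ^ 2 - 1) * y ^ 2 = w ^ 2 + 16 := by
    apply mul_left_cancel₀ (pow_ne_zero 2 hu); linarith
  have hu2 : u % 2 = 0 := by
    have := sq_emod_eight u; have := sq_emod_eight v; omega
  obtain ⟨q, hq⟩ : ∃ q, u ^ 2 = 4 * q := ⟨u ^ 2 / 4, by have := sq_emod_eight u; omega⟩
  rw [hq] at h1
  obtain ⟨w, rfl⟩ : 2 ∣ w := dvd_of_mul_sq_eq (c := 1)
    (e := (4 * q - 1) * y ^ 2 - 8) Int.prime_two (by norm_num) (by linarith)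
  obtain ⟨y, rfl⟩ : 2 ∣ y := dvd_of_mul_sq_eq (c := 4 * q - 1)
    (e := w ^ 2 + 4) Int.prime_two (by omega) (by linarith)
  obtain ⟨w, rfl⟩ : 2 ∣ w := dvd_of_mul_sq_eq (c := 1)
    (e := (4 * q - 1) * y ^ 2 - 2) Int.prime_two (by norm_num) (by linarith)
  obtain ⟨y, rfl⟩ : 2 ∣ y := dvd_of_mul_sq_eq (c := 4 * q - 1)
    (e := w ^ 2 + 1) Int.prime_two (by omega) (by linarith)
  have h2 : 2 * (4 * q - 1) * y ^ 2 = w ^ 2 + 1 := by linarith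
  have h3 := congrArg (Int.cast : ℤ → ZMod 8) h2
  push_cast at h3
  generalize (q : ZMod 8) = q, (w : ZMod 8) = w, (y : ZMod 8) = y at h3
  revert q w y; decide

theorem no_solution_five {a b y z : ℤ} (ha : a ≠ 0) (hab : 10 * a ^ 2 + 1 = b ^ 2)
    (h : (50 * a ^ 2 - 8) * (50 * a ^ 2) * y ^ 2 = 8 * 5 * z ^ 2 + 16 * (50 * a ^ 2) * 5) :
    False := by
  obtain ⟨w, rfl⟩ : a ∣ z := dvd_of_sq_dvd_two_mul_sq
    ⟨5 * (25 * a ^ 2 - 4) * y ^ 2 - 200, by linarith⟩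
  have h1 : 5 * (25 * a ^ 2 - 4) * y ^ 2 = 2 * w ^ 2 + 200 := by
    apply mul_left_cancel₀ (pow_ne_zero 2 ha); linarith
  obtain ⟨w, rfl⟩ : 5 ∣ w := dvd_of_mul_sq_eq (c := 2) (e := (25 * a ^ 2 - 4) * y ^ 2 - 40)
    prime_five_int (by norm_num) (by linarith)
  obtain ⟨y, rfl⟩ : 5 ∣ y := dvd_of_mul_sq_eq (c := 25 * a ^ 2 - 4) (e := 2 * w ^ 2 + 8)
    prime_five_int (by omega) (by linarith)
  obtain ⟨s, rfl⟩ : 2 ∣ a := by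
    have := sq_emod_eight a; have := sq_emod_eight b; omega
  obtain ⟨w, rfl⟩ : 2 ∣ w := dvd_of_mul_sq_eq (c := 1) (e := 5 * (25 * s ^ 2 - 1) * y ^ 2 - 2)
    Int.prime_two (by norm_num) (by linarith)
  have h2 : (25 * s ^ 2 - 1) * (5 * y ^ 2) = 2 * (w ^ 2 + 1) := by linarith
  obtain ⟨r, rfl⟩ | hs := Int.even_or_odd s
  · obtain ⟨y, rfl⟩ : 2 ∣ y := dvd_of_mul_sq_eq (c := 5 * (25 * (r + r) ^ 2 - 1))
      (e := w ^ 2 + 1) Int.prime_two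
      (by have := sq_emod_eight (r + r); omega) (by linarith)
    have h3 : 10 * (100 * r ^ 2 - 1) * y ^ 2 = w ^ 2 + 1 := by linarith
    have h4 := congrArg (Int.cast : ℤ → ZMod 8) h3
    push_cast at h4
    generalize (r : ZMod 8) = r, (w : ZMod 8) = w, (y : ZMod 8) = y at h4
    revert r w y; decide
  · have hs1 : 8 ∣ (25 * s ^ 2 - 1) * (5 * y ^ 2) := Dvd.dvd.mul_right
      (by have := sq_emod_eight s; have := Int.odd_iff.1 hs; omega) _
    have := sq_emod_eight w
    omega

theorem no_solution_six_of_sq {a y z : ℤ} (ha : a % 2 = 1)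
    (h : (3 * a ^ 2 - 8) * (3 * a ^ 2) * y ^ 2 = 8 * 6 * z ^ 2 + 16 * (3 * a ^ 2) * 6) :
    False := by
  have ha0 : a ≠ 0 := by rintro rfl; simp at ha
  obtain ⟨w, rfl⟩ : a ∣ z := dvd_of_sq_dvd_two_pow_mul_sq 4 ha
    ⟨(3 * a ^ 2 - 8) * y ^ 2 - 96, by linarith⟩
  have h1 : (3 * a ^ 2 - 8) * y ^ 2 = 16 * w ^ 2 + 96 := by
    apply mul_left_cancel₀ (pow_ne_zero 2 ha0); linarith
  have ha8 := sq_emod_eight a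
  obtain ⟨q, hq⟩ : ∃ q, a ^ 2 = 8 * q + 1 := ⟨a ^ 2 / 8, by omega⟩
  rw [hq] at h1
  obtain ⟨y, rfl⟩ : 2 ∣ y := dvd_of_mul_sq_eq (e := 8 * w ^ 2 + 48)
    Int.prime_two (by omega) (h1.trans (by ring))
  obtain ⟨y, rfl⟩ : 2 ∣ y := dvd_of_mul_sq_eq (c := 3 * (8 * q + 1) - 8)
    (e := 2 * w ^ 2 + 12) Int.prime_two (by omega) (by linarith)
  have h2 : (3 * (8 * q + 1) - 8) * y ^ 2 = w ^ 2 + 6 := by linarith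
  have h3 := congrArg (Int.cast : ℤ → ZMod 8) h2
  push_cast at h3
  generalize (q : ZMod 8) = q, (w : ZMod 8) = w, (y : ZMod 8) = y at h3
  revert q w y; decide

theorem no_solution_six_of_six_mul_sq {a y z : ℤ} (ha : a ≠ 0)
    (h : (18 * a ^ 2 - 8) * (18 * a ^ 2) * y ^ 2 = 8 * 6 * z ^ 2 + 16 * (18 * a ^ 2) * 6) :
    False := by
  -- Here a² divides 8z² = 2(2z)² and a may be even, so the root is divided out of 2z instead of z.
  obtain ⟨w, hw⟩ : a ∣ 2 * z := dvd_of_sq_dvd_two_mul_sq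
    ⟨6 * (9 * a ^ 2 - 4) * y ^ 2 - 288, by linarith⟩
  have h1 : 3 * (9 * a ^ 2 - 4) * y ^ 2 = w ^ 2 + 144 := by
    apply mul_left_cancel₀ (pow_ne_zero 2 ha)
    have : (2 * z) ^ 2 = (a * w) ^ 2 := by rw [hw]
    linarith
  obtain ⟨w, rfl⟩ : 3 ∣ w := dvd_of_mul_sq_eq (c := 1) (e := (9 * a ^ 2 - 4) * y ^ 2 - 48)
    Int.prime_three (by norm_num) (by linarith)
  obtain ⟨y, rfl⟩ : 3 ∣ y := dvd_of_mul_sq_eq (c := 9 * a ^ 2 - 4) (e := w ^ 2 + 16)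
    Int.prime_three (by omega) (by linarith)
  have h2 : 3 * (9 * a ^ 2 - 4) * y ^ 2 = w ^ 2 + 16 := by linarith
  have h3 := congrArg (Int.cast : ℤ → ZMod 3) h2
  push_cast at h3
  generalize (a : ZMod 3) = a, (w : ZMod 3) = w, (y : ZMod 3) = y at h3
  revert a w y; decide

theorem no_solution_seven_of_fourteen_mul_sq {a y z : ℤ} (ha : a ≠ 0)
    (h : (98 * a ^ 2 - 8) * (98 * a ^ 2) * y ^ 2 = 8 * 7 * z ^ 2 + 16 * (98 * a ^ 2) * 7) :
    False := by
  obtain ⟨w, rfl⟩ : a ∣ z := dvd_of_sq_dvd_two_mul_sq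
    ⟨7 * (49 * a ^ 2 - 4) * y ^ 2 - 392, by linarith⟩
  have h1 : 7 * (49 * a ^ 2 - 4) * y ^ 2 = 2 * w ^ 2 + 392 := by
    apply mul_left_cancel₀ (pow_ne_zero 2 ha); linarith
  obtain ⟨w, rfl⟩ : 7 ∣ w := dvd_of_mul_sq_eq (c := 2) (e := (49 * a ^ 2 - 4) * y ^ 2 - 56)
    prime_seven_int (by norm_num) (by linarith)
  obtain ⟨y, rfl⟩ : 7 ∣ y := dvd_of_mul_sq_eq (c := 49 * a ^ 2 - 4) (e := 2 * w ^ 2 + 8)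
    prime_seven_int (by omega) (by linarith)
  have h2 : 7 * (49 * a ^ 2 - 4) * y ^ 2 = 2 * w ^ 2 + 8 := by linarith
  have h3 := congrArg (Int.cast : ℤ → ZMod 7) h2
  push_cast at h3
  generalize (a : ZMod 7) = a, (w : ZMod 7) = w, (y : ZMod 7) = y at h3
  revert a w y; decide

theorem no_solution_seven_of_seven_mul_sq {a y z : ℤ} (ha : a % 2 = 1)
    (h : (49 * a ^ 2 - 8) * (49 * a ^ 2) * y ^ 2 = 8 * 7 * z ^ 2 + 16 * (49 * a ^ 2) * 7) :
    False := by
  have ha0 : a ≠ 0 := by rintro rfl; simp at ha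
  obtain ⟨w, rfl⟩ : a ∣ z := dvd_of_sq_dvd_two_pow_mul_sq 3 ha
    ⟨7 * (49 * a ^ 2 - 8) * y ^ 2 - 784, by linarith⟩
  have h1 : 7 * (49 * a ^ 2 - 8) * y ^ 2 = 8 * w ^ 2 + 784 := by
    apply mul_left_cancel₀ (pow_ne_zero 2 ha0); linarith
  obtain ⟨w, rfl⟩ : 7 ∣ w := dvd_of_mul_sq_eq (c := 8) (e := (49 * a ^ 2 - 8) * y ^ 2 - 112)
    prime_seven_int (by norm_num) (by linarith)
  obtain ⟨y, rfl⟩ : 7 ∣ y := dvd_of_mul_sq_eq (c := 49 * a ^ 2 - 8) (e := 8 * w ^ 2 + 16)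
    prime_seven_int (by omega) (by linarith)
  have h2 : 7 * (49 * a ^ 2 - 8) * y ^ 2 = 8 * w ^ 2 + 16 := by linarith
  have h3 := congrArg (Int.cast : ℤ → ZMod 7) h2
  push_cast at h3
  generalize (a : ZMod 7) = a, (w : ZMod 7) = w, (y : ZMod 7) = y at h3
  revert a w y; decide

theorem exists_of_solution_of_sq {p m y z : ℤ} (hp : p = 1 ∨ p = 5) (hm : m % 2 = 1)
    (h : (p * m ^ 2 - 8) * (p * m ^ 2) * y ^ 2 = 8 * p * z ^ 2 + 16 * (p * m ^ 2) * p) :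
    ∃ Y Z : ℤ, (p * m ^ 2 - 8) * Y ^ 2 = p + 8 * Z ^ 2 := by
  have hm0 : m ≠ 0 := by rintro rfl; simp at hm
  have hp0 : p ≠ 0 := by omega
  have h0 : m ^ 2 * ((p * m ^ 2 - 8) * y ^ 2 - 16 * p) = 2 ^ 3 * z ^ 2 := by
    apply mul_left_cancel₀ hp0; linarith
  obtain ⟨w, rfl⟩ : m ∣ z := dvd_of_sq_dvd_two_pow_mul_sq 3 hm ⟨_, h0.symm⟩
  have h1 : (p * m ^ 2 - 8) * y ^ 2 = 8 * w ^ 2 + 16 * p := by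
    apply mul_left_cancel₀ (pow_ne_zero 2 hm0); linarith
  have hm8 := sq_emod_eight m
  have hodd : ¬ 2 ∣ p * m ^ 2 - 8 := by rcases hp with rfl | rfl <;> omega
  obtain ⟨y, rfl⟩ : 2 ∣ y := dvd_of_mul_sq_eq (e := 4 * w ^ 2 + 8 * p)
    Int.prime_two hodd (h1.trans (by ring))
  obtain ⟨y, rfl⟩ : 2 ∣ y := dvd_of_mul_sq_eq (e := w ^ 2 + 2 * p)
    Int.prime_two hodd (by linarith)
  obtain ⟨w, rfl⟩ : 2 ∣ w := dvd_of_mul_sq_eq (c := 1)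
    (e := (p * m ^ 2 - 8) * y ^ 2 - p) Int.prime_two (by norm_num) (by linarith)
  have h2 : (p * m ^ 2 - 8) * y ^ 2 = 2 * w ^ 2 + p := by linarith
  -- An odd w would give py² ≡ p + 2, that is y² ≡ 3, modulo 8. Evenness turns 2w² into the required
  -- 8Z².
  obtain ⟨w, rfl⟩ : 2 ∣ w := by
    obtain ⟨q, hq⟩ : ∃ q, m ^ 2 = 8 * q + 1 := ⟨m ^ 2 / 8, by omega⟩
    rw [hq] at h2
    by_contra hw
    obtain ⟨v, rfl⟩ : ∃ v, w = 2 * v + 1 := ⟨w / 2, by omega⟩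
    rcases hp with rfl | rfl
    all_goals
      have h3 := congrArg (Int.cast : ℤ → ZMod 8) h2
      push_cast at h3
      generalize (q : ZMod 8) = q, (v : ZMod 8) = v, (y : ZMod 8) = y at h3
      revert q v y; decide
  exact ⟨y, w, by linarith⟩

/-! ### The cases S' = 1, ..., 8 through the square condition. -/

theorem dvd_of_sq_eq_mul {p c e : ℤ} (hp : Prime p) (h : c ^ 2 = p * e) : p ∣ c :=
  hp.dvd_of_dvd_pow ⟨e, h⟩

theorem exists_eq_prime_mul_of_sq {p S c : ℤ} (hp : Prime p) (hp2 : ¬ p ∣ 2)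
    (h : 2 * S * p * (S + p) = c ^ 2) : ∃ T f, S = p * T ∧ 2 * p * (T * (T + 1)) = f ^ 2 := by
  obtain ⟨f, rfl⟩ := dvd_of_sq_eq_mul (e := 2 * S * (S + p)) hp (by linarith)
  have h1 : 2 * (S * (S + p)) = p * f ^ 2 := by
    apply mul_left_cancel₀ hp.ne_zero; linarith
  have h2 : p ∣ S := by
    rcases hp.dvd_mul.1 ((hp.dvd_mul.1 ⟨_, h1⟩).resolve_left hp2) with h | h
    · exact h
    · exact (dvd_add_left dvd_rfl).1 h
  obtain ⟨T, rfl⟩ := h2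
  have h3 : 2 * p * (T * (T + 1)) = f ^ 2 := by
    apply mul_left_cancel₀ hp.ne_zero; linarith
  exact ⟨T, f, rfl, h3⟩

theorem sq_ne_of_between {a n : ℤ} (ha : 0 ≤ a) (h1 : a ^ 2 < n) (h2 : n < (a + 1) ^ 2) (c : ℤ) :
    n ≠ c ^ 2 := by
  rintro rfl
  have h3 := abs_lt_of_sq_lt_sq h2 (by omega)
  have h4 := sq_lt_sq' (a := |c|) (b := a + 1) (by have := abs_nonneg c; omega) h3
  have h5 : a < |c| := lt_of_pow_lt_pow_left₀ 2 (abs_nonneg c) (by rwa [sq_abs])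
  omega

theorem isCoprime_self_add_one (T : ℤ) : IsCoprime T (T + 1) := ⟨-1, 1, by ring⟩

theorem exists_negative_pell_of_one {S y z c : ℤ} (hS : 8 < S) (hc : 2 * S * 1 * (S + 1) = c ^ 2)
    (h : (S - 8) * S * y ^ 2 = 8 * 1 * z ^ 2 + 16 * S * 1) :
    ∃ m n : ℤ, S = m ^ 2 ∧ m ^ 2 - 2 * n ^ 2 = -1 ∧
      ∃ Y Z : ℤ, (m ^ 2 - 8) * Y ^ 2 = 1 + 8 * Z ^ 2 := by
  obtain ⟨d₁, d₂, hd, a, b, ha, hb⟩ := exists_sq_of_squarefree_mul_coprime (d := 2)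
    Nat.prime_two.squarefree (by omega) (by omega) (isCoprime_self_add_one S)
    (c := c) (by push_cast; linarith)
  obtain ⟨rfl, rfl⟩ | ⟨rfl, rfl⟩ : (d₁ = 1 ∧ d₂ = 2) ∨ (d₁ = 2 ∧ d₂ = 1) := by
    have : d₁ ≤ 2 := Nat.le_of_dvd (by norm_num) ⟨_, hd.symm⟩
    interval_cases d₁ <;> omega
  · push_cast at ha hb
    have hm : a % 2 = 1 := by have := sq_emod_eight a; omega
    obtain ⟨Y, Z, hYZ⟩ := exists_of_solution_of_sq (p := 1) (m := a) (y := y) (z := z)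
      (Or.inl rfl) hm (by rw [← ha]; exact h)
    exact ⟨a, b, by linarith, by linarith, Y, Z, by simpa using hYZ⟩
  · push_cast at ha hb
    subst ha
    exact (no_solution_one (by rintro rfl; norm_num at hS) (by linarith) h).elim

theorem two_mul_mul_ne_sq_of_two {S c : ℤ} (hS : 8 < S) (hc : 2 * S * 2 * (S + 2) = c ^ 2) : False := by
  obtain ⟨f, rfl⟩ := dvd_of_sq_eq_mul (e := 2 * S * (S + 2)) Int.prime_two (by linarith)
  refine sq_ne_of_between (a := S) (n := S * (S + 2)) (by omega) (by nlinarith) (by nlinarith) f ?_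
  linarith

theorem two_mul_mul_ne_sq_of_eight {S c : ℤ} (hS : 8 < S) (hc : 2 * S * 8 * (S + 8) = c ^ 2) : False := by
  obtain ⟨f, rfl⟩ := dvd_of_sq_eq_mul (e := 8 * S * (S + 8)) Int.prime_two (by linarith)
  obtain ⟨f, rfl⟩ := dvd_of_sq_eq_mul (c := f) (e := 2 * S * (S + 8)) Int.prime_two (by linarith)
  -- (S + 3)² < S(S + 8) < (S + 4)², the left inequality needing 2S > 9.
  refine sq_ne_of_between (a := S + 3) (n := S * (S + 8)) (by omega) (by nlinarith)
    (by nlinarith) f ?_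
  linarith

theorem no_solution_of_sq_of_three {S y z c : ℤ} (hS : 8 < S) (hc : 2 * S * 3 * (S + 3) = c ^ 2)
    (h : (S - 8) * S * y ^ 2 = 8 * 3 * z ^ 2 + 16 * S * 3) : False := by
  obtain ⟨T, f, rfl, hf⟩ := exists_eq_prime_mul_of_sq Int.prime_three (by norm_num) hc
  obtain ⟨d₁, d₂, hd, a, b, ha, hb⟩ := exists_sq_of_squarefree_mul_coprime (d := 6)
    (by decide +kernel) (by omega) (by omega) (isCoprime_self_add_one T)
    (c := f) (by push_cast; linarith)
  obtain ⟨rfl, rfl⟩ | ⟨rfl, rfl⟩ | ⟨rfl, rfl⟩ | ⟨rfl, rfl⟩ : (d₁ = 1 ∧ d₂ = 6) ∨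
      (d₁ = 2 ∧ d₂ = 3) ∨ (d₁ = 3 ∧ d₂ = 2) ∨ (d₁ = 6 ∧ d₂ = 1) := by
    have : d₁ ≤ 6 := Nat.le_of_dvd (by norm_num) ⟨_, hd.symm⟩
    interval_cases d₁ <;> omega
  all_goals push_cast at ha hb; subst ha
  · have h3 := congrArg (Int.cast : ℤ → ZMod 3) hb
    push_cast at h3
    generalize (a : ZMod 3) = a, (b : ZMod 3) = b at h3
    revert a b; decide
  · exact no_solution_three_of_two_mul_sq (a := a) (y := y) (z := z)
      (by have := sq_emod_eight a; have := sq_emod_eight b; omega) (by linarith)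
  · have h3 := congrArg (Int.cast : ℤ → ZMod 3) hb
    push_cast at h3
    generalize (a : ZMod 3) = a, (b : ZMod 3) = b at h3
    revert a b; decide
  · exact no_solution_three_of_six_mul_sq (a := a) (y := y) (z := z)
      (by rintro rfl; norm_num at hS) (by linarith)

theorem no_solution_of_sq_of_four {S y z c : ℤ} (hS : 8 < S) (hc : 2 * S * 4 * (S + 4) = c ^ 2)
    (h : (S - 8) * S * y ^ 2 = 8 * 4 * z ^ 2 + 16 * S * 4) : False := by
  obtain ⟨f, rfl⟩ := dvd_of_sq_eq_mul (c := c) (e := 4 * S * (S + 4)) Int.prime_two (by linarith)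
  obtain ⟨f, rfl⟩ := dvd_of_sq_eq_mul (c := f) (e := S * (S + 4)) Int.prime_two (by linarith)
  obtain ⟨T, rfl⟩ : 2 ∣ S := by
    rcases Int.prime_two.dvd_mul.1 (⟨f ^ 2, by linarith⟩ : 2 ∣ S * (S + 4)) with h | h <;> omega
  obtain ⟨f, rfl⟩ := dvd_of_sq_eq_mul (c := f) (e := T * (T + 2)) Int.prime_two (by linarith)
  obtain ⟨U, rfl⟩ : 2 ∣ T := by
    rcases Int.prime_two.dvd_mul.1 (⟨f ^ 2, by linarith⟩ : 2 ∣ T * (T + 2)) with h | h <;> omega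
  obtain ⟨d₁, d₂, hd, a, b, ha, hb⟩ := exists_sq_of_squarefree_mul_coprime (d := 2)
    Nat.prime_two.squarefree (by omega) (by omega) (isCoprime_self_add_one U)
    (c := f) (by push_cast; linarith)
  obtain ⟨rfl, rfl⟩ | ⟨rfl, rfl⟩ : (d₁ = 1 ∧ d₂ = 2) ∨ (d₁ = 2 ∧ d₂ = 1) := by
    have : d₁ ≤ 2 := Nat.le_of_dvd (by norm_num) ⟨_, hd.symm⟩
    interval_cases d₁ <;> omega
  all_goals push_cast at ha hb; subst ha
  · exact no_solution_four_of_sq (a := a) (y := y) (z := z)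
      (by have := sq_emod_eight a; omega) (by linarith)
  · exact no_solution_four_of_two_mul_sq (u := a) (v := b) (y := y) (z := z)
      (by rintro rfl; norm_num at hS) (by linarith) (by linarith)

theorem exists_negative_pell_of_five {S y z c : ℤ} (hS : 8 < S) (hc : 2 * S * 5 * (S + 5) = c ^ 2)
    (h : (S - 8) * S * y ^ 2 = 8 * 5 * z ^ 2 + 16 * S * 5) :
    ∃ m n : ℤ, S = 5 * m ^ 2 ∧ m ^ 2 - 10 * n ^ 2 = -1 ∧
      ∃ Y Z : ℤ, (5 * m ^ 2 - 8) * Y ^ 2 = 5 + 8 * Z ^ 2 := by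
  obtain ⟨T, f, rfl, hf⟩ := exists_eq_prime_mul_of_sq prime_five_int (by norm_num) hc
  obtain ⟨d₁, d₂, hd, a, b, ha, hb⟩ := exists_sq_of_squarefree_mul_coprime (d := 10)
    (by decide +kernel) (by omega) (by omega) (isCoprime_self_add_one T)
    (c := f) (by push_cast; linarith)
  obtain ⟨rfl, rfl⟩ | ⟨rfl, rfl⟩ | ⟨rfl, rfl⟩ | ⟨rfl, rfl⟩ : (d₁ = 1 ∧ d₂ = 10) ∨
      (d₁ = 2 ∧ d₂ = 5) ∨ (d₁ = 5 ∧ d₂ = 2) ∨ (d₁ = 10 ∧ d₂ = 1) := by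
    have : d₁ ≤ 10 := Nat.le_of_dvd (by norm_num) ⟨_, hd.symm⟩
    interval_cases d₁ <;> omega
  all_goals push_cast at ha hb; subst ha
  · have hm : a % 2 = 1 := by have := sq_emod_eight a; omega
    obtain ⟨Y, Z, hYZ⟩ := exists_of_solution_of_sq (p := 5) (m := a) (y := y) (z := z)
      (Or.inr rfl) hm (by linarith)
    exact ⟨a, b, by linarith, by linarith, Y, Z, hYZ⟩
  · exfalso
    have h3 := congrArg (Int.cast : ℤ → ZMod 5) hb
    push_cast at h3
    generalize (a : ZMod 5) = a, (b : ZMod 5) = b at h3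
    revert a b; decide
  · exfalso
    have h3 := congrArg (Int.cast : ℤ → ZMod 5) hb
    push_cast at h3
    generalize (a : ZMod 5) = a, (b : ZMod 5) = b at h3
    revert a b; decide
  · exact (no_solution_five (a := a) (b := b) (y := y) (z := z)
      (by rintro rfl; norm_num at hS) (by linarith) (by linarith)).elim

theorem no_solution_of_sq_of_six {S y z c : ℤ} (hS : 8 < S) (hc : 2 * S * 6 * (S + 6) = c ^ 2)
    (h : (S - 8) * S * y ^ 2 = 8 * 6 * z ^ 2 + 16 * S * 6) : False := by
  obtain ⟨f, rfl⟩ := dvd_of_sq_eq_mul (c := c) (e := 6 * S * (S + 6)) Int.prime_two (by linarith)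
  obtain ⟨f, rfl⟩ := dvd_of_sq_eq_mul (c := f) (e := S * (S + 6)) Int.prime_three (by linarith)
  obtain ⟨T, rfl⟩ : 3 ∣ S := by
    rcases Int.prime_three.dvd_mul.1 (⟨f ^ 2, by linarith⟩ : 3 ∣ S * (S + 6)) with h | h <;> omega
  have hd_cases {d₁ d₂ : ℕ} (hd : d₁ * d₂ = 3) : (d₁ = 1 ∧ d₂ = 3) ∨ (d₁ = 3 ∧ d₂ = 1) := by
    have : d₁ ≤ 3 := Nat.le_of_dvd (by norm_num) ⟨_, hd.symm⟩
    interval_cases d₁ <;> omega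
  obtain ⟨U, rfl | rfl⟩ := Int.even_or_odd' T
  · obtain ⟨f, rfl⟩ := dvd_of_sq_eq_mul (c := f) (e := 6 * U * (U + 1)) Int.prime_two
      (by linarith)
    obtain ⟨d₁, d₂, hd, a, b, ha, hb⟩ := exists_sq_of_squarefree_mul_coprime (d := 3)
      Nat.prime_three.squarefree (by omega) (by omega) (isCoprime_self_add_one U)
      (c := f) (by push_cast; linarith)
    obtain ⟨rfl, rfl⟩ | ⟨rfl, rfl⟩ := hd_cases hd
    all_goals push_cast at ha hb; subst ha
    · have h3 := congrArg (Int.cast : ℤ → ZMod 3) hb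
      push_cast at h3
      generalize (a : ZMod 3) = a, (b : ZMod 3) = b at h3
      revert a b; decide
    · exact no_solution_six_of_six_mul_sq (a := a) (y := y) (z := z)
        (by rintro rfl; norm_num at hS) (by linarith)
  -- For odd T the factors T and T + 2 are already coprime; for even T, halving both was needed.
  · obtain ⟨d₁, d₂, hd, a, b, ha, hb⟩ := exists_sq_of_squarefree_mul_coprime (d := 3)
      (A := 2 * U + 1) (B := 2 * U + 3)
      Nat.prime_three.squarefree (by omega) (by omega) ⟨U + 1, -U, by ring⟩
      (c := f) (by push_cast; linarith)
    obtain ⟨rfl, rfl⟩ | ⟨rfl, rfl⟩ := hd_cases hd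
    all_goals push_cast at ha hb
    · rw [ha] at h
      exact no_solution_six_of_sq (a := a) (y := y) (z := z)
        (by have := sq_emod_eight a; omega) (by linarith)
    · have h3 := congrArg (Int.cast : ℤ → ZMod 3)
        (show b ^ 2 = 3 * a ^ 2 + 2 by linarith)
      push_cast at h3
      generalize (a : ZMod 3) = a, (b : ZMod 3) = b at h3
      revert a b; decide

theorem no_solution_of_sq_of_seven {S y z c : ℤ} (hS : 8 < S) (hc : 2 * S * 7 * (S + 7) = c ^ 2)
    (h : (S - 8) * S * y ^ 2 = 8 * 7 * z ^ 2 + 16 * S * 7) : False := by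
  obtain ⟨T, f, rfl, hf⟩ := exists_eq_prime_mul_of_sq prime_seven_int (by norm_num) hc
  obtain ⟨d₁, d₂, hd, a, b, ha, hb⟩ := exists_sq_of_squarefree_mul_coprime (d := 14)
    (by decide +kernel) (by omega) (by omega) (isCoprime_self_add_one T)
    (c := f) (by push_cast; linarith)
  obtain ⟨rfl, rfl⟩ | ⟨rfl, rfl⟩ | ⟨rfl, rfl⟩ | ⟨rfl, rfl⟩ : (d₁ = 1 ∧ d₂ = 14) ∨
      (d₁ = 2 ∧ d₂ = 7) ∨ (d₁ = 7 ∧ d₂ = 2) ∨ (d₁ = 14 ∧ d₂ = 1) := by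
    have : d₁ ≤ 14 := Nat.le_of_dvd (by norm_num) ⟨_, hd.symm⟩
    interval_cases d₁ <;> omega
  all_goals push_cast at ha hb; subst ha
  · have h3 := congrArg (Int.cast : ℤ → ZMod 7) hb
    push_cast at h3
    generalize (a : ZMod 7) = a, (b : ZMod 7) = b at h3
    revert a b; decide
  · have h3 := congrArg (Int.cast : ℤ → ZMod 7) hb
    push_cast at h3
    generalize (a : ZMod 7) = a, (b : ZMod 7) = b at h3
    revert a b; decide
  · exact no_solution_seven_of_seven_mul_sq (a := a) (y := y) (z := z)
      (by have := sq_emod_eight a; omega) (by linarith)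
  · exact no_solution_seven_of_fourteen_mul_sq (a := a) (y := y) (z := z)
      (by rintro rfl; norm_num at hS) (by linarith)

/-! ### The case S' ≥ 9. -/

theorem no_solution_seventyTwo_nine {y z : ℤ}
    (h : (72 - 8) * 72 * y ^ 2 = 8 * 9 * z ^ 2 + 16 * 72 * 9) : False := by
  obtain ⟨z, rfl⟩ : 2 ∣ z := dvd_of_sq_eq_mul (e := 32 * y ^ 2 - 72) Int.prime_two (by linarith)
  obtain ⟨z, rfl⟩ : 2 ∣ z := dvd_of_sq_eq_mul (e := 8 * y ^ 2 - 18) Int.prime_two (by linarith)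
  have h1 : z ^ 2 = 4 * y ^ 2 - 9 := by linarith
  have := sq_emod_eight z
  omega

theorem no_solution_nine_seventyTwo {y z : ℤ}
    (h : (9 - 8) * 9 * y ^ 2 = 8 * 72 * z ^ 2 + 16 * 9 * 72) : False := by
  obtain ⟨y, rfl⟩ : 2 ∣ y := dvd_of_sq_eq_mul (e := 32 * z ^ 2 + 576) Int.prime_two (by linarith)
  obtain ⟨y, rfl⟩ : 2 ∣ y := dvd_of_sq_eq_mul (e := 8 * z ^ 2 + 144) Int.prime_two (by linarith)
  obtain ⟨y, rfl⟩ : 2 ∣ y := dvd_of_sq_eq_mul (e := 2 * z ^ 2 + 36) Int.prime_two (by linarith)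
  have h1 : y ^ 2 = z ^ 2 + 18 := by linarith
  have := sq_emod_eight z
  have := sq_emod_eight y
  omega

theorem lt_of_mul_lt_of_nine_le {m n : ℕ} (hm : 9 ≤ m) (hm' : m < 18)
    (h : 23 * m * n < 200 * (m + n)) : n < 260 := by
  interval_cases m <;> omega

theorem isSporadic_of_ge {S S' : ℕ} {c y z : ℤ} (hS : 9 ≤ S) (hS' : 9 ≤ S')
    (hc : 2 * (S : ℤ) * S' * (S + S') = c ^ 2)
    (h : ((S : ℤ) - 8) * S * y ^ 2 = 8 * S' * z ^ 2 + 16 * S * S')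
    (hb : 23 * S * S' < 200 * (S + S')) : IsSporadic S S' := by
  rw [← sq_abs, ← Int.natCast_natAbs] at hc
  have hc' : 2 * S * S' * (S + S') = c.natAbs * c.natAbs := by
    rw [← sq]; exact_mod_cast hc
  rcases le_total S S' with hle | hle
  · have h1 : S < 18 := by
      by_contra! h1
      nlinarith
    have h2 : S' < 260 := lt_of_mul_lt_of_nine_le hS h1 (by linarith)
    rcases isSporadic_or_of_sq S h1 hS S' h2 hS' hb (by rw [hc', Nat.sqrt_eq]) with h3 | ⟨rfl, rfl⟩
    · exact h3
    · exact (no_solution_nine_seventyTwo (y := y) (z := z) (by exact_mod_cast h)).elim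
  · have h1 : S' < 18 := by
      by_contra! h1
      nlinarith
    have h2 : S < 260 := lt_of_mul_lt_of_nine_le hS' h1 (by linarith)
    have hc2 : 2 * S' * S * (S' + S) = c.natAbs * c.natAbs := by rw [← hc']; ring
    rcases isSporadic_or_of_sq S' h1 hS' S h2 hS (by linarith) (by rw [hc2, Nat.sqrt_eq])
      with h3 | ⟨rfl, rfl⟩
    · clear hc hc' hc2 h
      -- The list is symmetric except for (18, 32), whose reversal violates `hb`.
      simp only [IsSporadic, List.mem_cons, Prod.mk.injEq, List.not_mem_nil, or_false] at h3 ⊢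
      rcases h3 with ⟨rfl, rfl⟩ | ⟨rfl, rfl⟩ | ⟨rfl, rfl⟩ | ⟨rfl, rfl⟩ | ⟨rfl, rfl⟩ |
        ⟨rfl, rfl⟩ | ⟨rfl, rfl⟩ <;> simp at hb ⊢
    · exact (no_solution_seventyTwo_nine (y := y) (z := z) (by exact_mod_cast h)).elim

theorem isSporadic_of_nine_le {y z k S S' : ℕ} {x : ℤ} (hy : 0 < y) (hz : 0 < z)
    (hk : 16 < k) (hkyz : y * z < k) (hS9 : 9 ≤ S) (hS9' : 9 ≤ S')
    (hS : (S : ℤ) * (k - 16) = 8 * ((z : ℤ) ^ 2 + k))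
    (hS' : (S' : ℤ) * k = (y : ℤ) ^ 2 * S) (hx : 8 * x ^ 2 = k * ((S : ℤ) + S'))
    {c : ℤ} (hc : 2 * (S : ℤ) * S' * (S + S') = c ^ 2)
    (h : ((S : ℤ) - 8) * S * (y : ℤ) ^ 2 = 8 * S' * (z : ℤ) ^ 2 + 16 * S * S') :
    IsSporadic S S' := by
  rcases lt_or_ge k 200 with hk2 | hk2
  · obtain ⟨j, rfl⟩ : ∃ j, k = j + 16 := ⟨k - 16, by omega⟩
    have e1 : 8 * (z * z + (j + 16)) = (j + 16 - 16) * S := by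
      rw [Nat.add_sub_cancel]; zify; push_cast at hS; linarith
    have e2 : 8 * (z * z + (j + 16)) / (j + 16 - 16) = S := by
      rw [e1]; exact Nat.mul_div_cancel_left _ (by omega)
    have e3 : y * y * S = (j + 16) * S' := by
      zify; push_cast at hS'; linarith
    have e4 : y * y * S / (j + 16) = S' := by
      rw [e3]; exact Nat.mul_div_cancel_left _ (by omega)
    rw [← sq_abs, ← Int.natCast_natAbs] at hx
    have e5 : (j + 16) * (S + S') = 8 * (x.natAbs * x.natAbs) := by
      zify; push_cast at hx ⊢; linarith
    have e6 : (j + 16) * (S + S') / 8 = x.natAbs * x.natAbs := by omega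
    have hyz : y ≤ (j + 16 - 1) / z := (Nat.le_div_iff_mul_le hz).2 (by omega)
    have hzk : z < j + 16 := lt_of_le_of_lt (Nat.le_mul_of_pos_left z hy) hkyz
    have := isSporadic_of_lt_two_hundred (j + 16) hk2 hk z hzk hz ⟨_, e1⟩ y (by omega)
      (by rw [e2]; exact ⟨_, e3⟩)
    rw [e2, e4, e6] at this
    exact this hS9' (by rw [Nat.sqrt_eq, e5])
  · apply isSporadic_of_ge hS9 hS9' hc h
    have hkpos : (0 : ℤ) < k := by omega
    have hSpos : (0 : ℤ) < S := by omega
    have hSpos' : (0 : ℤ) < S' := by omega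
    have hlt : ((y : ℤ) * z) ^ 2 < (k : ℤ) ^ 2 := by
      have : ((y : ℤ) * z) < k := by exact_mod_cast hkyz
      exact pow_lt_pow_left₀ this (by positivity) two_ne_zero
    -- The left side equals 8S(yz)², so this is yz < k. Dividing by k and inserting k ≥ 200 gives
    -- 184SS' < 1600(S + S'), the bound 23SS' < 200(S + S').
    have h1 : (k : ℤ) * (S' * (k * (S - 8) - 16 * S)) < k * (8 * S * k) := by
      have : (k : ℤ) * (S' * (k * (S - 8) - 16 * S)) = 8 * S * (y * z : ℤ) ^ 2 := by
        linear_combination ((k : ℤ) * (S - 8) - 16 * S) * hS' + (y : ℤ) ^ 2 * S * hS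
      nlinarith
    have h2 : (k : ℤ) * (S * S' - 8 * S - 8 * S') < 16 * (S * S') := by
      have := lt_of_mul_lt_mul_left h1 hkpos.le
      linarith
    have h3 : (0 : ℤ) < S * S' := by positivity
    have hk3 : (200 : ℤ) ≤ k := by exact_mod_cast hk2
    zify
    by_contra! h4
    have h5 : (0 : ℤ) ≤ S * S' - 8 * S - 8 * S' := by nlinarith
    nlinarith [mul_le_mul_of_nonneg_right hk3 h5]

/-! ### Reduction to the two integer conditions, and the case split on S'. -/

theorem theorem4 (y z k : ℕ) (hy : 0 < y) (hz : 0 < z)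
    (hk : 16 < k) (hkyz : y * z < k)
    (S S' x : ℤ)
    (hS : (S : ℝ) = 8 * ((z : ℝ) ^ 2 + (k : ℝ)) / ((k : ℝ) - 16))
    (hS' : (S' : ℝ) = (y : ℝ) ^ 2 * (S : ℝ) / (k : ℝ))
    (hx : (x : ℝ) = Real.sqrt ((k : ℝ) * ((S : ℝ) + (S' : ℝ)) / 8)) :
    ((S, S') = (9, 9) ∨ (S, S') = (12, 24) ∨ (S, S') = (16, 16) ∨ (S, S') = (24, 12) ∨
      (S, S') = (10, 40) ∨ (S, S') = (40, 10) ∨ (S, S') = (18, 32)) ∨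
    (∃ m : ℤ, (S, S') = (5 * m ^ 2, 5) ∧
      ∃ n Y Z : ℤ, m ^ 2 - 10 * n ^ 2 = -1 ∧ (5 * m ^ 2 - 8) * Y ^ 2 = 5 + 8 * Z ^ 2) ∨
    (∃ m : ℤ, (S, S') = (m ^ 2, 1) ∧
      ∃ n Y Z : ℤ, m ^ 2 - 2 * n ^ 2 = -1 ∧ (m ^ 2 - 8) * Y ^ 2 = 1 + 8 * Z ^ 2) := by
  have hkR : (16 : ℝ) < k := by exact_mod_cast hk
  have e1 : S * ((k : ℤ) - 16) = 8 * ((z : ℤ) ^ 2 + k) := by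
    rw [eq_div_iff (by linarith)] at hS
    exact_mod_cast hS
  have e2 : S' * (k : ℤ) = (y : ℤ) ^ 2 * S := by
    rw [eq_div_iff (by linarith)] at hS'
    exact_mod_cast hS'
  have hkZ : (16 : ℤ) < k := by exact_mod_cast hk
  have hyZ : (0 : ℤ) < y := by exact_mod_cast hy
  have hzZ : (0 : ℤ) < z := by exact_mod_cast hz
  have hS8 : 8 < S := by
    by_contra! hle
    nlinarith
  have hSpos' : 0 < S' := by
    have : 0 < S' * (k : ℤ) := by rw [e2]; positivity
    exact pos_of_mul_pos_left this (by omega)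
  have e3 : 8 * x ^ 2 = k * (S + S') := by
    have hSR : (0 : ℝ) < S := by exact_mod_cast (by omega : 0 < S)
    have hSR' : (0 : ℝ) < S' := by exact_mod_cast hSpos'
    have : 8 * (x : ℝ) ^ 2 = k * (S + S') := by
      rw [hx, Real.sq_sqrt (by positivity)]; ring
    exact_mod_cast this
  have e4 : (S - 8) * S * (y : ℤ) ^ 2 = 8 * S' * (z : ℤ) ^ 2 + 16 * S * S' := by
    linear_combination S' * e1 - (S - 8) * e2
  obtain ⟨c, hc⟩ : ∃ c, 2 * S * S' * (S + S') = c ^ 2 := by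
    -- Replacing y²S by S'k and k(S + S') by 8x² leaves 16x²S'². Hence y divides 4xS', and the
    -- quotient is c.
    have h1 : (y : ℤ) ^ 2 * (2 * S * S' * (S + S')) = (4 * x * S') ^ 2 := by
      linear_combination (-2) * S' * (S + S') * e2 - 2 * S' ^ 2 * e3
    obtain ⟨c, hc⟩ := (Int.pow_dvd_pow_iff two_ne_zero).1 ⟨_, h1.symm⟩
    refine ⟨c, mul_left_cancel₀ (pow_ne_zero 2 hyZ.ne') ?_⟩
    rw [h1, hc]; ring
  rcases lt_or_ge 8 S' with h9 | h9
  · left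
    lift S to ℕ using by omega
    lift S' to ℕ using by omega
    have := isSporadic_of_nine_le hy hz hk hkyz (by omega) (by omega) e1 e2 e3 hc e4
    simp only [IsSporadic, List.mem_cons, Prod.mk.injEq, List.not_mem_nil, or_false] at this ⊢
    exact_mod_cast this
  · right
    interval_cases S'
    · obtain ⟨m, n, rfl, hn, Y, Z, hYZ⟩ := exists_negative_pell_of_one hS8 hc e4
      exact Or.inr ⟨m, rfl, n, Y, Z, hn, hYZ⟩
    · exact (two_mul_mul_ne_sq_of_two hS8 hc).elim
    · exact (no_solution_of_sq_of_three hS8 hc e4).elim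
    · exact (no_solution_of_sq_of_four hS8 hc e4).elim
    · obtain ⟨m, n, rfl, hn, Y, Z, hYZ⟩ := exists_negative_pell_of_five hS8 hc e4
      exact Or.inl ⟨m, rfl, n, Y, Z, hn, hYZ⟩
    · exact (no_solution_of_sq_of_six hS8 hc e4).elim
    · exact (no_solution_of_sq_of_seven hS8 hc e4).elim
    · exact (two_mul_mul_ne_sq_of_eight hS8 hc).elim
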